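/- Let $\tau>0$ and $t_0\in\mathbb R$, and consider the delayed Richardson system $$\begin{aligned}x'(t)&=k(t)y(t-\tau)-a(t)x(t-\tau)+g(t,x(t),y(t),x(t-\tau),y(t-\tau)),\\ y'(t)&=l(t)x(t-\tau)-b(t)y(t-\tau)+h(t,y(t),x(t),y(t-\tau),x(t-\tau)),\end{aligned}\qquad(1)$$ where $a,b,k,l:[t_0,\infty)\to[0,\infty)$ are continuous, $a$ and $b$ are positive, and $g,h:[t_0,\infty)\times\mathbb R^4\to\mathbb R$ are continuous. For $\sigma\ge t_0$ and $\sigma<\omega\le\infty$, a solution of (1) on $[\sigma-\tau,\omega)$ is a pair of continuous functions $x,y:[\sigma-\tau,\omega)\to\mathbb R$ that are differentiable on $[\sigma,\omega)$ (from the right at $\sigma$) and satisfy (1) there; it has initial condition $\phi=(\phi_1,\phi_2)\in C([-\tau,0];\mathbb R^2)$ at time $\sigma$ if $x(\sigma+\theta)=\phi_1(\theta)$ and $y(\sigma+\theta)=\phi_2(\theta)$ for $\theta\in[-\tau,0]$. Let $|\cdot|$ be the maximum norm and $\|\phi\|=\max_{-\tau\le\theta\le0}|\phi(\theta)|$. Assume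 that: (i) $\int_{t_0}^\infty a(t)\,dt=\infty$ and $\int_{t_0}^\infty b(t)\,dt=\infty$; (ii) there are continuous functions $G,H:[t_0,\infty)\to[0,\infty)$ such that for all $t\ge t_0$ and $(x,y,u,v)\in\mathbb R^4$ $$|g(t,x,y,u,v)|\le G(t)\,|(x,y,u,v)|,\qquad |h(t,x,y,u,v)|\le H(t)\,|(x,y,u,v)|;$$ (iii) $\limsup_{t\to\infty}B_i(t)<1$ for $i=1,2$, where, for $t\ge t_0+\tau$, $$B_1(t)=\frac{k(t)+G(t)}{a(t)}+\int_{t-\tau}^t\big(a(s)+k(s)+G(s)\big)\,ds,\qquad B_2(t)=\frac{l(t)+H(t)}{b(t)}+\int_{t-\tau}^t\big(b(s)+l(s)+H(s)\big)\,ds.$$ Then the zero solution of (1) is stable, that is, for all $\sigma\ge t_0$ and $\varepsilon>0$ there is $\delta>0$ such that every solution $(x,y)$ on an interval $[\sigma-\tau,\omega)$ with initial condition $\phi$ at $\sigma$, $\|\phi\|<\delta$, satisfies $|(x(t),y(t))|<\varepsilon$ for all $t\in[\sigma,\omega)$; and it attracts all solutions, that is, every solution on $[\sigma-\tau,\infty)$,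 for any $\sigma\ge t_0$ and any initial condition, satisfies $(x(t),y(t))\to(0,0)$ as $t\to\infty$. Moreover, if (ii) and (iii) hold and (i) is replaced by (i') $\liminf_{t\to\infty}a(t)>0$ and $\liminf_{t\to\infty}b(t)>0$, then the zero solution is globally exponentially stable: there are $K,\alpha>0$ such that for all $\sigma\ge t_0$, all $\phi\in C([-\tau,0];\mathbb R^2)$ and every solution $(x,y)$ on an interval $[\sigma-\tau,\omega)$ with initial condition $\phi$ at $\sigma$, $$|(x(t),y(t))|\le K e^{-\alpha(t-\sigma)}\|\phi\|\qquad\text{for all }t\in[\sigma,\omega).$$ -/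

import Mathlib

open Filter Topology Set

noncomputable section

/-- The data of a two-dimensional non-autonomous Richardson system with one constant delay `τ`:
  `x'(t) = k(t) y(t-τ) - a(t) x(t-τ) + g(t, x(t), y(t), x(t-τ), y(t-τ))`,
  `y'(t) = l(t) x(t-τ) - b(t) y(t-τ) + h(t, y(t), x(t), y(t-τ), x(t-τ))`.
Only the values of the functions at times `t ≥ t₀` matter, where `t₀` is the left end of the
time axis on which the system is studied. -/
structure RichardsonSystem where
  τ : ℝ
  a : ℝ → ℝ
  b : ℝ → ℝ
  k : ℝ → ℝ
  l : ℝ → ℝ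
  g : ℝ → ℝ → ℝ → ℝ → ℝ → ℝ
  h : ℝ → ℝ → ℝ → ℝ → ℝ → ℝ

namespace RichardsonSystem

variable (S : RichardsonSystem)

/-- Continuous initial functions `φ = (φ₁, φ₂) : [-τ, 0] → ℝ²`; the norm is the supremum norm
built on the maximum norm of `ℝ × ℝ`. -/
abbrev Phase : Type := C(Icc (-S.τ) (0 : ℝ), ℝ × ℝ)

/-- `(x, y)` is a solution on `[σ - τ, ω)` with initial time `σ`, where `σ < ω ≤ ∞`: both functions
are continuous on `[σ - τ, ω)`, and on `[σ, ω)` they are differentiable (one-sidedly at `σ`) and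
satisfy the equations. Values outside `[σ - τ, ω)` are irrelevant. -/
structure IsSolution (σ : ℝ) (ω : EReal) (x y : ℝ → ℝ) : Prop where
  lt : (σ : EReal) < ω
  continuousOn_fst : ContinuousOn x {t : ℝ | σ - S.τ ≤ t ∧ (t : EReal) < ω}
  continuousOn_snd : ContinuousOn y {t : ℝ | σ - S.τ ≤ t ∧ (t : EReal) < ω}
  deriv_fst : ∀ t : ℝ, σ ≤ t → (t : EReal) < ω →
    HasDerivWithinAt x
      (S.k t * y (t - S.τ) - S.a t * x (t - S.τ)
        + S.g t (x t) (y t) (x (t - S.τ)) (y (t - S.τ))) (Ici σ) t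
  deriv_snd : ∀ t : ℝ, σ ≤ t → (t : EReal) < ω →
    HasDerivWithinAt y
      (S.l t * x (t - S.τ) - S.b t * y (t - S.τ)
        + S.h t (y t) (x t) (y (t - S.τ)) (x (t - S.τ))) (Ici σ) t

/-- `x(σ + θ) = φ₁(θ)` and `y(σ + θ) = φ₂(θ)` for `θ ∈ [-τ, 0]`. -/
def HasInitialCondition (σ : ℝ) (φ : S.Phase) (x y : ℝ → ℝ) : Prop :=
  ∀ θ : Icc (-S.τ) (0 : ℝ), x (σ + θ) = (φ θ).1 ∧ y (σ + θ) = (φ θ).2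

/-- The zero solution is (Lyapunov) stable: for each initial time `σ ≥ t₀` and each `ε > 0` there
is `δ > 0` such that every solution starting at `σ` from an initial function of norm `< δ`
stays of norm `< ε` as long as it is defined. -/
def ZeroStable (t₀ : ℝ) : Prop :=
  ∀ σ : ℝ, t₀ ≤ σ → ∀ ε : ℝ, 0 < ε → ∃ δ : ℝ, 0 < δ ∧
    ∀ φ : S.Phase, ‖φ‖ < δ → ∀ (ω : EReal) (x y : ℝ → ℝ),
      S.IsSolution σ ω x y → S.HasInitialCondition σ φ x y →
        ∀ t : ℝ, σ ≤ t → (t : EReal) < ω → max |x t| |y t| < ε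

/-- The zero solution attracts all solutions: every solution on `[σ - τ, ∞)`, for every initial
time `σ ≥ t₀` and every (continuous) initial function, tends to zero. -/
def ZeroGloballyAttractive (t₀ : ℝ) : Prop :=
  ∀ σ : ℝ, t₀ ≤ σ → ∀ (φ : S.Phase) (x y : ℝ → ℝ),
    S.IsSolution σ ⊤ x y → S.HasInitialCondition σ φ x y →
      Tendsto x atTop (𝓝 0) ∧ Tendsto y atTop (𝓝 0)

/-- The zero solution is globally exponentially stable: there are `K, α > 0`, independent of the
initial time and of the initial function, such that `|(x(t), y(t))| ≤ K e^{-α (t - σ)} ‖φ‖`. -/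
def ZeroGloballyExponentiallyStable (t₀ : ℝ) : Prop :=
  ∃ K α : ℝ, 0 < K ∧ 0 < α ∧ ∀ σ : ℝ, t₀ ≤ σ → ∀ (φ : S.Phase) (ω : EReal) (x y : ℝ → ℝ),
    S.IsSolution σ ω x y → S.HasInitialCondition σ φ x y →
      ∀ t : ℝ, σ ≤ t → (t : EReal) < ω →
        max |x t| |y t| ≤ K * Real.exp (-α * (t - σ)) * ‖φ‖

/-- `B₁(t) = (k(t) + G(t)) / a(t) + ∫_{t-τ}^t (a + k + G)`. -/
def B₁ (G : ℝ → ℝ) (t : ℝ) : ℝ :=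
  (S.k t + G t) / S.a t + ∫ s in (t - S.τ)..t, (S.a s + S.k s + G s)

/-- `B₂(t) = (l(t) + H(t)) / b(t) + ∫_{t-τ}^t (b + l + H)`. -/
def B₂ (H : ℝ → ℝ) (t : ℝ) : ℝ :=
  (S.l t + H t) / S.b t + ∫ s in (t - S.τ)..t, (S.b s + S.l s + H s)

end RichardsonSystem

end

/-! The delayed feedback is traded for undelayed damping: x' + a x = (k y(t-τ) + g) + a (x(t) -
x(t-τ)). If |(x, y)| ≤ m on [t-2τ, t], then |x'| ≤ (a + k + G) m on [t-τ, t], which bounds x(t) -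
x(t-τ), and altogether |x' + a x| ≤ a B₁ m (`abs_field_add_le`). The equation for y is the same one
for `swap`. Since eventually B₁, B₂ ≤ β < 1, damping dominates.

Decay is a Halanay argument (`max_abs_le_exp_neg`): where a component first touches W(t) = N'
exp(-α(t-p)), the recent past is at most W exp(2ατ), so x x' ≤ -a (1 - β exp(2ατ)) W², which is less
than W W' = -α W² once α < a (1 - β exp(2ατ)). For α = 0 positivity of a and b suffices and
stability follows; some α > 0 works when a and b are eventually bounded away from 0. Before B₁, B₂ ≤
β takes effect, a Grönwall bound controls growth, uniformly in the initial time.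

For attractivity, divergence of ∫a and ∫b lets an integrating factor improve any eventual bound m to
β' m, with β < β' < 1; iteration gives convergence to 0. -/

/-! ### First exit through a barrier -/

theorem HasDerivAt.nonneg_of_forall_le_left {f : ℝ → ℝ} {d p t : ℝ} (hf : HasDerivAt f d t)
    (hpt : p < t) (h : ∀ s ∈ Ioo p t, f s ≤ f t) : 0 ≤ d := by
  have h1 : Tendsto (slope f t) (𝓝[<] t) (𝓝 d) :=
    (hasDerivWithinAt_iff_tendsto_slope' (by simp)).1 (hf.hasDerivWithinAt (s := Iio t))
  refine ge_of_tendsto h1 ?_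
  filter_upwards [Ioo_mem_nhdsLT hpt] with s hs
  rw [slope_def_field]
  exact div_nonneg_of_nonpos (by linarith [h s hs]) (by linarith [hs.2])

/-- First-exit principle: a pair of functions starting below the barrier `w` stays below it if,
as long as it has not exceeded the barrier, neither component can cross it. -/
theorem max_abs_lt_of_barrier {x y w x' y' w' : ℝ → ℝ} {p q : ℝ}
    (hx : ContinuousOn x (Icc p q)) (hy : ContinuousOn y (Icc p q))
    (hw : ContinuousOn w (Icc p q))
    (hx' : ∀ t ∈ Ioc p q, HasDerivAt x (x' t) t) (hy' : ∀ t ∈ Ioc p q, HasDerivAt y (y' t) t)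
    (hw' : ∀ t ∈ Ioc p q, HasDerivAt w (w' t) t)
    (h0 : max |x p| |y p| < w p)
    (hstep : ∀ t ∈ Ioc p q, (∀ s ∈ Icc p t, max |x s| |y s| ≤ w s) →
      (|x t| = w t → x t * x' t < w t * w' t) ∧ (|y t| = w t → y t * y' t < w t * w' t)) :
    ∀ t ∈ Icc p q, max |x t| |y t| < w t := by
  by_contra! hcon
  obtain ⟨t₁, ht₁, hle⟩ := hcon
  have hmc : ContinuousOn (fun t => max |x t| |y t|) (Icc p q) := hx.abs.sup hy.abs
  have hK : IsCompact (Icc p q ∩ {t | w t ≤ max |x t| |y t|}) := by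
    refine isCompact_Icc.of_isClosed_subset ?_ inter_subset_left
    exact isClosed_Icc.isClosed_le hw hmc
  obtain ⟨t, ⟨htI, hte⟩, hmin⟩ := hK.exists_isLeast ⟨t₁, ht₁, hle⟩
  have hpt : p < t := by
    rcases eq_or_lt_of_le htI.1 with h | h
    · subst h; exact absurd h0 (not_lt.2 hte)
    · exact h
  have hlt : ∀ s ∈ Ico p t, max |x s| |y s| < w s := by
    intro s hs
    by_contra! hcon
    exact absurd (hmin ⟨⟨hs.1, hs.2.le.trans htI.2⟩, hcon⟩) (not_le.2 hs.2)
  have hsub : Ico p t ⊆ Icc p q := fun s hs => ⟨hs.1, hs.2.le.trans htI.2⟩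
  have hcl : t ∈ closure (Ico p t) := by
    rw [closure_Ico hpt.ne]; exact ⟨hpt.le, le_rfl⟩
  have htle : max |x t| |y t| ≤ w t :=
    ContinuousWithinAt.closure_le hcl ((hmc t htI).mono hsub) ((hw t htI).mono hsub)
      fun s hs => (hlt s hs).le
  have hall : ∀ s ∈ Icc p t, max |x s| |y s| ≤ w s := by
    intro s hs
    rcases eq_or_lt_of_le hs.2 with h | h
    · rw [h]; exact htle
    · exact (hlt s ⟨hs.1, h⟩).le
  have htq : t ∈ Ioc p q := ⟨hpt, htI.2⟩
  obtain ⟨h1, h2⟩ := hstep t htq hall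
  have key : ∀ f f' : ℝ → ℝ, HasDerivAt f (f' t) t → (∀ s ∈ Icc p t, |f s| ≤ w s) →
      (|f t| = w t → f t * f' t < w t * w' t) → |f t| ≠ w t := by
    intro f f' hf hfw hcross heq
    -- f² - w² is nonpositive up to t and vanishes at t, so its derivative there is nonnegative.
    -- Squaring avoids differentiating |f|.
    have hd := (hf.mul hf).sub ((hw' t htq).mul (hw' t htq))
    have h0 := hd.nonneg_of_forall_le_left hpt (by
      intro s hs
      have e1 := hfw s ⟨hs.1.le, hs.2.le⟩
      have e2 : f s * f s ≤ w s * w s := by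
        rw [← abs_mul_abs_self (f s)]
        exact mul_self_le_mul_self (abs_nonneg _) e1
      have e3 : f t * f t = w t * w t := by rw [← abs_mul_abs_self (f t), heq]
      simp only [Pi.sub_apply, Pi.mul_apply]
      linarith)
    nlinarith [hcross heq]
  have hxn := key x x' (hx' t htq) (fun s hs => (le_max_left _ _).trans (hall s hs)) h1
  have hyn := key y y' (hy' t htq) (fun s hs => (le_max_right _ _).trans (hall s hs)) h2
  rcases max_choice |x t| |y t| with h | h
  · exact hxn (le_antisymm (h ▸ htle) (h ▸ hte))
  · exact hyn (le_antisymm (h ▸ htle) (h ▸ hte))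

/-! ### Primitives on a half-line and the integrating factor -/

theorem hasDerivAt_integral_of_continuousOn_Ici {f : ℝ → ℝ} {t₀ p t : ℝ}
    (hf : ContinuousOn f (Ici t₀)) (hp : t₀ ≤ p) (ht : t₀ < t) :
    HasDerivAt (fun u => ∫ s in p..u, f s) (f t) t := by
  have hsub : uIcc p t ⊆ Ici t₀ := fun s hs => (le_min hp ht.le).trans hs.1
  refine intervalIntegral.integral_hasDerivAt_right
    (hf.mono hsub).intervalIntegrable ?_ (hf.continuousAt (Ici_mem_nhds ht))
  exact (hf.mono Ioi_subset_Ici_self).stronglyMeasurableAtFilter isOpen_Ioi t ht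

theorem ContinuousOn.intervalIntegrable_of_Ici {f : ℝ → ℝ} {t₀ p q : ℝ}
    (hf : ContinuousOn f (Ici t₀)) (hp : t₀ ≤ p) (hq : t₀ ≤ q) :
    IntervalIntegrable f MeasureTheory.volume p q :=
  (hf.mono fun _ hs => (le_min hp hq).trans hs.1).intervalIntegrable

theorem continuousOn_integral_of_continuousOn_Ici {f : ℝ → ℝ} {t₀ p q : ℝ}
    (hf : ContinuousOn f (Ici t₀)) (hp : t₀ ≤ p) (hpq : p ≤ q) :
    ContinuousOn (fun u => ∫ s in p..u, f s) (Icc p q) := by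
  rw [← uIcc_of_le hpq]
  exact intervalIntegral.continuousOn_primitive_interval
    ((hf.mono fun s hs => (le_min hp (hp.trans hpq)).trans hs.1).integrableOn_compact
      isCompact_uIcc)

/-- If `f' + a f ≤ a c` and `∫ a = ∞`, then `limsup f ≤ c`. -/
theorem eventually_le_of_deriv_add_mul_le {a f f' : ℝ → ℝ} {t₀ p c c' : ℝ}
    (ha : ContinuousOn a (Ici t₀)) (hp : t₀ < p)
    (hdiv : Tendsto (fun T => ∫ t in t₀..T, a t) atTop atTop)
    (hf : ∀ t, p ≤ t → HasDerivAt f (f' t) t)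
    (hle : ∀ t, p ≤ t → f' t + a t * f t ≤ a t * c) (hc : c < c') :
    ∀ᶠ t in atTop, f t ≤ c' := by
  set A : ℝ → ℝ := fun t => ∫ s in t₀..t, a s
  have hA : ∀ t, p ≤ t → HasDerivAt A (a t) t := fun t ht =>
    hasDerivAt_integral_of_continuousOn_Ici ha le_rfl (hp.trans_le ht)
  -- The differential inequality says exactly that u is nonincreasing, so f - c ≤ u(p) exp(-A),
  -- which tends to 0.
  set u : ℝ → ℝ := fun t => (f t - c) * Real.exp (A t)
  have hu : ∀ t, p ≤ t →
      HasDerivAt u (f' t * Real.exp (A t) + (f t - c) * (Real.exp (A t) * a t)) t :=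
    fun t ht => ((hf t ht).sub_const c).mul (hA t ht).exp
  have hanti : AntitoneOn u (Ici p) := by
    refine antitoneOn_of_hasDerivWithinAt_nonpos (convex_Ici p)
      (f' := fun t => f' t * Real.exp (A t) + (f t - c) * (Real.exp (A t) * a t))
      (fun t ht => (hu t ht).continuousAt.continuousWithinAt)
      (fun t ht => (hu t (interior_subset ht)).hasDerivWithinAt) ?_
    intro t ht
    have h1 := hle t (interior_subset ht)
    have h2 := Real.exp_pos (A t)
    have : f' t * Real.exp (A t) + (f t - c) * (Real.exp (A t) * a t)
        = Real.exp (A t) * (f' t + a t * f t - a t * c) := by ring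
    simp only [this]
    exact mul_nonpos_of_nonneg_of_nonpos h2.le (by linarith)
  have hlim : Tendsto (fun t => u p * Real.exp (-A t)) atTop (𝓝 (u p * 0)) :=
    (Real.tendsto_exp_neg_atTop_nhds_zero.comp hdiv).const_mul _
  rw [mul_zero] at hlim
  filter_upwards [hlim.eventually (gt_mem_nhds (sub_pos.2 hc)), eventually_ge_atTop p]
    with t ht htp
  have h1 : u t ≤ u p := hanti (mem_Ici.2 le_rfl) htp htp
  have h2 : f t - c = u t * Real.exp (-A t) := by
    simp only [u]; rw [mul_assoc, ← Real.exp_add]; simp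
  have h3 := mul_le_mul_of_nonneg_right h1 (Real.exp_pos (-A t)).le
  linarith

/-! ### Pointwise estimates for one equation -/

namespace RichardsonSystem

variable {S : RichardsonSystem} {t₀ σ : ℝ} {ω : EReal} {G H x y : ℝ → ℝ}

/-- The system satisfied by `(y, x)` when `(x, y)` solves `S`. -/
def swap (S : RichardsonSystem) : RichardsonSystem :=
  ⟨S.τ, S.b, S.a, S.l, S.k, S.h, S.g⟩

theorem IsSolution.swap (h : S.IsSolution σ ω x y) : S.swap.IsSolution σ ω y x :=
  ⟨h.lt, h.continuousOn_snd, h.continuousOn_fst, h.deriv_snd, h.deriv_fst⟩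

/-- The standing assumptions on the coefficients of the first equation. -/
structure FirstBounds (S : RichardsonSystem) (t₀ : ℝ) (G : ℝ → ℝ) : Prop where
  τ_pos : 0 < S.τ
  a_cont : ContinuousOn S.a (Ici t₀)
  k_cont : ContinuousOn S.k (Ici t₀)
  G_cont : ContinuousOn G (Ici t₀)
  a_pos : ∀ t, t₀ ≤ t → 0 < S.a t
  k_nonneg : ∀ t, t₀ ≤ t → 0 ≤ S.k t
  G_nonneg : ∀ t, t₀ ≤ t → 0 ≤ G t
  g_le : ∀ t, t₀ ≤ t → ∀ x y u v : ℝ,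
      |S.g t x y u v| ≤ G t * max (max |x| |y|) (max |u| |v|)

/-- The total size `a + k + G` of the first equation. -/
def rate (S : RichardsonSystem) (G : ℝ → ℝ) (t : ℝ) : ℝ := S.a t + S.k t + G t

/-- The right-hand side of the first equation along `(x, y)`. -/
def field (S : RichardsonSystem) (x y : ℝ → ℝ) (t : ℝ) : ℝ :=
  S.k t * y (t - S.τ) - S.a t * x (t - S.τ) + S.g t (x t) (y t) (x (t - S.τ)) (y (t - S.τ))

theorem IsSolution.hasDerivAt (h : S.IsSolution σ ω x y) {t : ℝ} (ht : σ < t)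
    (htω : (t : EReal) < ω) : HasDerivAt x (S.field x y t) t :=
  (h.deriv_fst t ht.le htω).hasDerivAt (Ici_mem_nhds ht)

theorem IsSolution.continuousOn_Icc (h : S.IsSolution σ ω x y) {p q : ℝ}
    (hp : σ - S.τ ≤ p) (hq : (q : EReal) < ω) : ContinuousOn x (Icc p q) :=
  h.continuousOn_fst.mono fun _ ht =>
    ⟨hp.trans ht.1, (EReal.coe_le_coe_iff.2 ht.2).trans_lt hq⟩

namespace FirstBounds

theorem rate_cont (hS : S.FirstBounds t₀ G) : ContinuousOn (S.rate G) (Ici t₀) :=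
  (hS.a_cont.add hS.k_cont).add hS.G_cont

theorem rate_pos (hS : S.FirstBounds t₀ G) {t : ℝ} (ht : t₀ ≤ t) : 0 < S.rate G t := by
  have := hS.a_pos t ht
  have := hS.k_nonneg t ht
  have := hS.G_nonneg t ht
  unfold rate
  linarith

theorem abs_k_mul_add_g_le (hS : S.FirstBounds t₀ G) {t m : ℝ} (ht : t₀ ≤ t)
    (h1 : max |x t| |y t| ≤ m) (h2 : max |x (t - S.τ)| |y (t - S.τ)| ≤ m) :
    |S.k t * y (t - S.τ) + S.g t (x t) (y t) (x (t - S.τ)) (y (t - S.τ))|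
      ≤ (S.k t + G t) * m := by
  have hk := hS.k_nonneg t ht
  have e1 := hS.g_le t ht (x t) (y t) (x (t - S.τ)) (y (t - S.τ))
  have e2 := mul_le_mul_of_nonneg_left (max_le h1 h2) (hS.G_nonneg t ht)
  have e3 := mul_le_mul_of_nonneg_left ((le_max_right _ _).trans h2) hk
  refine (abs_add_le _ _).trans ?_
  rw [abs_mul, abs_of_nonneg hk]
  linarith

theorem abs_field_le (hS : S.FirstBounds t₀ G) {t m : ℝ} (ht : t₀ ≤ t)
    (h1 : max |x t| |y t| ≤ m) (h2 : max |x (t - S.τ)| |y (t - S.τ)| ≤ m) :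
    |S.field x y t| ≤ S.rate G t * m := by
  have e1 := hS.abs_k_mul_add_g_le ht h1 h2
  have ha := (hS.a_pos t ht).le
  have e2 := mul_le_mul_of_nonneg_left ((le_max_left _ _).trans h2) ha
  have e3 : S.field x y t = (S.k t * y (t - S.τ) + S.g t (x t) (y t) (x (t - S.τ)) (y (t - S.τ)))
      - S.a t * x (t - S.τ) := by unfold field; ring
  rw [e3]
  refine (abs_sub _ _).trans ?_
  rw [abs_mul, abs_of_nonneg ha]
  unfold rate
  linarith

/-- The increment is controlled by |x'| on [t-τ, t], and x' there involves values back to t-2τ;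
hence the window of two delays. The condition t > σ + τ makes the equation available on all of [t-τ,
t). -/
theorem abs_sub_le_integral (hS : S.FirstBounds t₀ G) (h : S.IsSolution σ ω x y) (hσ : t₀ ≤ σ)
    {t m : ℝ} (ht : σ + S.τ < t) (htω : (t : EReal) < ω)
    (hm : ∀ s ∈ Icc (t - 2 * S.τ) t, max |x s| |y s| ≤ m) :
    |x t - x (t - S.τ)| ≤ (∫ s in (t - S.τ)..t, S.rate G s) * m := by
  have hτ := hS.τ_pos
  have hd : ∀ s ∈ Ico (t - S.τ) t, HasDerivAt x (S.field x y s) s := fun s hs =>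
    h.hasDerivAt (by linarith [hs.1]) ((EReal.coe_lt_coe_iff.2 hs.2).trans htω)
  have hB : ∀ s ∈ Ico (t - S.τ) t,
      HasDerivAt (fun u => (∫ r in (t - S.τ)..u, S.rate G r) * m) (S.rate G s * m) s :=
    fun s hs => (hasDerivAt_integral_of_continuousOn_Ici hS.rate_cont (by linarith)
      (by linarith [hs.1])).mul_const m
  -- Comparison with a primitive of the bound needs no integrability of x'.
  refine image_norm_le_of_norm_deriv_right_le_deriv_boundary'
    (f := fun s => x s - x (t - S.τ)) (f' := S.field x y)
    (a := t - S.τ) (b := t) ?_ ?_ (by simp) ?_ ?_ ?_ (right_mem_Icc.2 (by linarith))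
    (B := fun u => (∫ r in (t - S.τ)..u, S.rate G r) * m) (B' := fun s => S.rate G s * m)
  · exact (h.continuousOn_Icc (by linarith) htω).sub continuousOn_const
  · exact fun s hs => ((hd s hs).sub_const _).hasDerivWithinAt
  · exact (continuousOn_integral_of_continuousOn_Ici hS.rate_cont (by linarith)
      (by linarith)).mul continuousOn_const
  · exact fun s hs => (hB s hs).hasDerivWithinAt
  · intro s hs
    exact hS.abs_field_le (by linarith [hs.1]) (hm s ⟨by linarith [hs.1], hs.2.le⟩)
      (hm _ ⟨by linarith [hs.1], by linarith [hs.2]⟩)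

/-- Adding a(t) x(t) turns the delayed term into a(t) (x(t) - x(t-τ)); dividing the resulting bound
by a(t) produces exactly B₁. -/
theorem abs_field_add_le (hS : S.FirstBounds t₀ G) (h : S.IsSolution σ ω x y) (hσ : t₀ ≤ σ)
    {t m : ℝ} (ht : σ + S.τ < t) (htω : (t : EReal) < ω)
    (hm : ∀ s ∈ Icc (t - 2 * S.τ) t, max |x s| |y s| ≤ m) :
    |S.field x y t + S.a t * x t| ≤ S.a t * (S.B₁ G t * m) := by
  have hτ := hS.τ_pos
  have ht₀ : t₀ ≤ t := by linarith
  have ha := hS.a_pos t ht₀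
  have e1 := hS.abs_k_mul_add_g_le ht₀ (hm t ⟨by linarith, le_rfl⟩)
    (hm (t - S.τ) ⟨by linarith, by linarith⟩)
  have e2 := mul_le_mul_of_nonneg_left (hS.abs_sub_le_integral h hσ ht htω hm) ha.le
  have e3 : S.field x y t + S.a t * x t
      = (S.k t * y (t - S.τ) + S.g t (x t) (y t) (x (t - S.τ)) (y (t - S.τ)))
        + S.a t * (x t - x (t - S.τ)) := by unfold field; ring
  rw [e3]
  refine (abs_add_le _ _).trans ?_
  rw [abs_mul, abs_of_pos ha]
  have e4 : S.a t * (S.B₁ G t * m)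
      = (S.k t + G t) * m + S.a t * ((∫ s in (t - S.τ)..t, S.rate G s) * m) := by
    have : S.B₁ G t = (S.k t + G t) / S.a t + ∫ s in (t - S.τ)..t, S.rate G s := rfl
    rw [this]; field_simp
  linarith

theorem integral_rate_le_B₁ (hS : S.FirstBounds t₀ G) {t : ℝ} (ht : t₀ ≤ t) :
    ∫ s in (t - S.τ)..t, S.rate G s ≤ S.B₁ G t := by
  have : 0 ≤ (S.k t + G t) / S.a t :=
    div_nonneg (add_nonneg (hS.k_nonneg t ht) (hS.G_nonneg t ht)) (hS.a_pos t ht).le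
  exact le_add_of_nonneg_left this

/-- The crossing condition for the first component at an exponentially decaying barrier. -/
theorem mul_field_lt (hS : S.FirstBounds t₀ G) (h : S.IsSolution σ ω x y) (hσ : t₀ ≤ σ)
    {t W E α β : ℝ} (ht : σ + S.τ < t) (htω : (t : EReal) < ω) (hW : 0 < W) (hE : 0 < E)
    (hm : ∀ s ∈ Icc (t - 2 * S.τ) t, max |x s| |y s| ≤ W * E) (hB : S.B₁ G t ≤ β)
    (hα : α < S.a t * (1 - β * E)) (hx : |x t| = W) :
    x t * S.field x y t < W * (-α * W) := by
  have ha := hS.a_pos t (by linarith [hS.τ_pos])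
  have e1 := hS.abs_field_add_le h hσ ht htω hm
  have e2 : S.a t * (S.B₁ G t * (W * E)) ≤ S.a t * (β * (W * E)) := by gcongr
  have e3 : x t * (S.field x y t + S.a t * x t) ≤ W * (S.a t * (β * (W * E))) := by
    refine (le_abs_self _).trans ?_
    rw [abs_mul, hx]
    exact mul_le_mul_of_nonneg_left (e1.trans e2) hW.le
  have e4 : x t * x t = W * W := by rw [← abs_mul_abs_self, hx]
  have e5 := mul_lt_mul_of_pos_left hα (mul_pos hW hW)
  have e6 : x t * (S.field x y t + S.a t * x t)
      = x t * S.field x y t + S.a t * (W * W) := by rw [← e4]; ring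
  linarith

/-- An eventual bound on a solution improves to any factor exceeding the eventual bound of `B₁`
in the first component. -/
theorem eventually_abs_le (hS : S.FirstBounds t₀ G) (h : S.IsSolution σ ⊤ x y) (hσ : t₀ ≤ σ)
    (hdiv : Tendsto (fun T => ∫ t in t₀..T, S.a t) atTop atTop) {β β' m : ℝ} (hm : 0 < m)
    (hβ : β < β') (hB : ∀ᶠ t in atTop, S.B₁ G t ≤ β)
    (hxy : ∀ᶠ t in atTop, max |x t| |y t| ≤ m) :
    ∀ᶠ t in atTop, |x t| ≤ β' * m := by
  have hτ := hS.τ_pos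
  obtain ⟨p, hp⟩ := eventually_atTop.1 (hB.and hxy)
  -- From q on, the window [t-2τ, t] lies where the bound m is already valid.
  set q : ℝ := max p σ + 2 * S.τ
  have hpq : p + 2 * S.τ ≤ q := by simp [q]
  have hσq : σ + 2 * S.τ ≤ q := by simp [q]
  have hd : ∀ t, q ≤ t → HasDerivAt x (S.field x y t) t := fun t ht =>
    h.hasDerivAt (by linarith) (EReal.coe_lt_top t)
  have hle : ∀ t, q ≤ t → |S.field x y t + S.a t * x t| ≤ S.a t * (β * m) := by
    intro t ht
    have ha := hS.a_pos t (by linarith)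
    refine (hS.abs_field_add_le h hσ (by linarith) (EReal.coe_lt_top t)
      (fun s hs => (hp s (by linarith [hs.1])).2)).trans ?_
    have := (hp t (by linarith)).1
    gcongr
  have hlt : β * m < β' * m := mul_lt_mul_of_pos_right hβ hm
  have h1 := eventually_le_of_deriv_add_mul_le hS.a_cont (by linarith : t₀ < q) hdiv hd
    (fun t ht => (abs_le.1 (hle t ht)).2) hlt
  have h2 := eventually_le_of_deriv_add_mul_le hS.a_cont (by linarith : t₀ < q) hdiv
    (fun t ht => (hd t ht).neg)
    (fun t ht => by
      have := (abs_le.1 (hle t ht)).1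
      simp only [Pi.neg_apply]
      linarith) hlt
  filter_upwards [h1, h2] with t ht1 ht2
  exact abs_le.2 ⟨by simp only [Pi.neg_apply] at ht2; linarith, ht1⟩

end FirstBounds

/-! ### Growth and decay by barriers -/

/-- Grönwall-type bound for solutions on their whole interval of existence. -/
theorem IsSolution.max_abs_le_exp (h : S.IsSolution σ ω x y) (hS : S.FirstBounds t₀ G)
    (hS' : S.swap.FirstBounds t₀ H) (hσ : t₀ ≤ σ) {N : ℝ} (hN : 0 ≤ N)
    (h0 : ∀ s ∈ Icc (σ - S.τ) σ, max |x s| |y s| ≤ N) {t : ℝ} (ht : σ ≤ t)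
    (htω : (t : EReal) < ω) :
    max |x t| |y t| ≤ N * Real.exp (∫ s in σ..t, (S.rate G s + S.swap.rate H s)) := by
  have hτ := hS.τ_pos
  -- The sum strictly exceeds each rate, which gives the strict crossing inequality for both
  -- components.
  set c : ℝ → ℝ := fun s => S.rate G s + S.swap.rate H s
  have hc : ContinuousOn c (Ici t₀) := hS.rate_cont.add hS'.rate_cont
  have hcpos : ∀ s, t₀ ≤ s → 0 < c s := fun s hs => add_pos (hS.rate_pos hs) (hS'.rate_pos hs)
  -- The barrier must be positive and start strictly above the data; N' is sent to N at the end.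
  have main : ∀ N', N < N' → max |x t| |y t| < N' * Real.exp (∫ s in σ..t, c s) := by
    intro N' hN'
    have hN'0 : 0 < N' := hN.trans_lt hN'
    have hωs : ∀ s ∈ Ioc σ t, (s : EReal) < ω := fun s hs =>
      (EReal.coe_le_coe_iff.2 hs.2).trans_lt htω
    have hmono : ∀ r s, σ ≤ r → r ≤ s → ∫ u in σ..r, c u ≤ ∫ u in σ..s, c u := by
      intro r s hr hrs
      refine intervalIntegral.integral_mono_interval le_rfl hr hrs ?_
        (hc.intervalIntegrable_of_Ici hσ (by linarith))
      filter_upwards [MeasureTheory.ae_restrict_mem measurableSet_Ioc] with u hu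
      exact (hcpos u (hσ.trans hu.1.le)).le
    refine max_abs_lt_of_barrier (p := σ) (q := t) (x' := S.field x y)
      (y' := S.swap.field y x)
      (w := fun t => N' * Real.exp (∫ s in σ..t, c s))
      (w' := fun t => N' * (Real.exp (∫ s in σ..t, c s) * c t))
      (h.continuousOn_Icc (by linarith) htω) (h.swap.continuousOn_Icc (by
        change σ - S.τ ≤ σ; linarith) htω)
      (continuousOn_const.mul
        (continuousOn_integral_of_continuousOn_Ici hc hσ ht).rexp)
      (fun s hs => h.hasDerivAt hs.1 (hωs s hs))
      (fun s hs => h.swap.hasDerivAt hs.1 (hωs s hs))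
      (fun s hs => ((hasDerivAt_integral_of_continuousOn_Ici hc hσ
        (hσ.trans_lt hs.1)).exp).const_mul N')
      ?_ ?_ t (right_mem_Icc.2 ht)
    · simpa using (h0 σ ⟨by linarith, le_rfl⟩).trans_lt hN'
    · intro s hs hhist
      have hs₀ : t₀ ≤ s := hσ.trans hs.1.le
      set W := N' * Real.exp (∫ u in σ..s, c u) with hWdef
      have hW : 0 < W := mul_pos hN'0 (Real.exp_pos _)
      have hcur : max |x s| |y s| ≤ W := hhist s ⟨hs.1.le, le_rfl⟩
      have hdel : max |x (s - S.τ)| |y (s - S.τ)| ≤ W := by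
        rcases le_total σ (s - S.τ) with hr | hr
        · refine (hhist _ ⟨hr, by linarith⟩).trans ?_
          have := hmono _ s hr (by linarith)
          change N' * Real.exp _ ≤ N' * Real.exp _
          gcongr
        · refine (h0 _ ⟨by linarith [hs.1], hr⟩).trans ?_
          have h1 : 0 ≤ ∫ u in σ..s, c u := by
            simpa using hmono σ s le_rfl hs.1.le
          nlinarith [Real.one_le_exp h1]
      have key : ∀ f F R : ℝ, |f| = W → |F| ≤ R * W → R < c s →
          f * F < W * (N' * (Real.exp (∫ u in σ..s, c u) * c s)) := by
        intro f F R hf hF hR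
        calc f * F ≤ |f| * |F| := by rw [← abs_mul]; exact le_abs_self _
          _ ≤ W * (R * W) := by rw [hf]; gcongr
          _ < W * (c s * W) := by gcongr
          _ = _ := by rw [hWdef]; ring
      refine ⟨fun hx => key _ _ _ hx (hS.abs_field_le hs₀ hcur hdel) ?_,
        fun hy => key _ _ _ hy (hS'.abs_field_le hs₀ ?_ ?_) ?_⟩
      · exact lt_add_of_pos_right _ (hS'.rate_pos hs₀)
      · rwa [max_comm]
      · rwa [max_comm]
      · exact lt_add_of_pos_left _ (hS.rate_pos hs₀)
  have hlim : Tendsto (fun N' => N' * Real.exp (∫ s in σ..t, c s)) (𝓝[>] N)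
      (𝓝 (N * Real.exp (∫ s in σ..t, c s))) :=
    ((continuous_id.mul continuous_const).tendsto N).mono_left nhdsWithin_le_nhds
  exact ge_of_tendsto hlim (eventually_nhdsWithin_of_forall fun N' hN' => (main N' hN').le)

/-- Halanay-type decay estimate, starting at a time `p` where `B₁, B₂ ≤ β < 1` already holds. -/
theorem IsSolution.max_abs_le_exp_neg (h : S.IsSolution σ ω x y) (hS : S.FirstBounds t₀ G)
    (hS' : S.swap.FirstBounds t₀ H) (hσ : t₀ ≤ σ) {N α β p : ℝ} (hN : 0 ≤ N) (hα : 0 ≤ α)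
    (hp : σ + S.τ ≤ p) (hB₁ : ∀ t, p ≤ t → S.B₁ G t ≤ β) (hB₂ : ∀ t, p ≤ t → S.B₂ H t ≤ β)
    (haα : ∀ t, p ≤ t → α < S.a t * (1 - β * Real.exp (α * (2 * S.τ))))
    (hbα : ∀ t, p ≤ t → α < S.b t * (1 - β * Real.exp (α * (2 * S.τ))))
    (h0 : ∀ s ∈ Icc (p - 2 * S.τ) p, max |x s| |y s| ≤ N) {t : ℝ} (ht : p ≤ t)
    (htω : (t : EReal) < ω) :
    max |x t| |y t| ≤ N * Real.exp (-α * (t - p)) := by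
  have hτ := hS.τ_pos
  have main : ∀ N', N < N' → max |x t| |y t| < N' * Real.exp (-α * (t - p)) := by
    intro N' hN'
    have hN'0 : 0 < N' := hN.trans_lt hN'
    have hωs : ∀ s ∈ Ioc p t, (s : EReal) < ω := fun s hs =>
      (EReal.coe_le_coe_iff.2 hs.2).trans_lt htω
    have hwd : ∀ s, HasDerivAt (fun t => N' * Real.exp (-α * (t - p)))
        (-α * (N' * Real.exp (-α * (s - p)))) s := by
      intro s
      have := ((((hasDerivAt_id' s).sub_const p).const_mul (-α)).exp).const_mul N'
      exact this.congr_deriv (by ring)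
    refine max_abs_lt_of_barrier (p := p) (q := t) (x' := S.field x y)
      (y' := S.swap.field y x)
      (w := fun t => N' * Real.exp (-α * (t - p)))
      (w' := fun t => -α * (N' * Real.exp (-α * (t - p))))
      (h.continuousOn_Icc (by linarith) htω) (h.swap.continuousOn_Icc (by
        change σ - S.τ ≤ p; linarith) htω)
      (by fun_prop)
      (fun s hs => h.hasDerivAt (by linarith [hs.1]) (hωs s hs))
      (fun s hs => h.swap.hasDerivAt (by linarith [hs.1]) (hωs s hs))
      (fun s _ => hwd s) ?_ ?_ t (right_mem_Icc.2 ht)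
    · simpa using (h0 p ⟨by linarith, le_rfl⟩).trans_lt hN'
    · intro s hs hhist
      have hW : 0 < N' * Real.exp (-α * (s - p)) := mul_pos hN'0 (Real.exp_pos _)
      -- Going back by at most 2τ enlarges the barrier by at most exp(2ατ); before p the barrier
      -- formula exceeds N, so the initial bound fits under it.
      have hm : ∀ r ∈ Icc (s - 2 * S.τ) s,
          max |x r| |y r| ≤ N' * Real.exp (-α * (s - p)) * Real.exp (α * (2 * S.τ)) := by
        intro r hr
        have e1 : max |x r| |y r| ≤ N' * Real.exp (-α * (r - p)) := by
          rcases le_total p r with hpr | hpr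
          · exact hhist r ⟨hpr, hr.2⟩
          · refine (h0 r ⟨by linarith [hr.1, hs.1], hpr⟩).trans ?_
            have : 0 ≤ -α * (r - p) := by nlinarith
            nlinarith [Real.one_le_exp this]
        refine e1.trans ?_
        rw [mul_assoc, ← Real.exp_add]
        have : -α * (r - p) ≤ -α * (s - p) + α * (2 * S.τ) := by nlinarith [hr.1]
        gcongr
      refine ⟨fun hx => hS.mul_field_lt h hσ (by linarith [hs.1]) (hωs s hs) hW
        (Real.exp_pos _) hm (hB₁ s hs.1.le) (haα s hs.1.le) hx, fun hy => ?_⟩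
      refine hS'.mul_field_lt h.swap hσ (by change σ + S.τ < s; linarith [hs.1]) (hωs s hs) hW
        (Real.exp_pos _) (fun r hr => ?_) (hB₂ s hs.1.le) (hbα s hs.1.le) hy
      rw [max_comm]
      exact hm r hr
  have hlim : Tendsto (fun N' => N' * Real.exp (-α * (t - p))) (𝓝[>] N)
      (𝓝 (N * Real.exp (-α * (t - p)))) :=
    ((continuous_id.mul continuous_const).tendsto N).mono_left nhdsWithin_le_nhds
  exact ge_of_tendsto hlim (eventually_nhdsWithin_of_forall fun N' hN' => (main N' hN').le)

theorem HasInitialCondition.max_abs_le {φ : S.Phase} (h : S.HasInitialCondition σ φ x y) :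
    ∀ s ∈ Icc (σ - S.τ) σ, max |x s| |y s| ≤ ‖φ‖ := by
  intro s hs
  have h1 := h ⟨s - σ, by linarith [hs.1], by linarith [hs.2]⟩
  simp only [add_sub_cancel] at h1
  rw [h1.1, h1.2]
  exact φ.norm_coe_le_norm _

/-! ### Uniformity in the initial time -/

/-- A bound valid until the delay time after `max σ T`, with a constant independent of the initial
time `σ`. -/
theorem exists_uniform_bound (hS : S.FirstBounds t₀ G) (hS' : S.swap.FirstBounds t₀ H) {T : ℝ}
    (hT : t₀ ≤ T) (hB₁ : ∀ t, T ≤ t → S.B₁ G t ≤ 1) (hB₂ : ∀ t, T ≤ t → S.B₂ H t ≤ 1) :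
    ∃ C : ℝ, ∀ σ, t₀ ≤ σ → ∀ (φ : S.Phase) (ω : EReal) (x y : ℝ → ℝ),
      S.IsSolution σ ω x y → S.HasInitialCondition σ φ x y →
      ∀ t, σ - S.τ ≤ t → t ≤ max σ T + S.τ → (t : EReal) < ω →
        max |x t| |y t| ≤ ‖φ‖ * Real.exp C := by
  have hτ := hS.τ_pos
  set c : ℝ → ℝ := fun s => S.rate G s + S.swap.rate H s
  have hc : ContinuousOn c (Ici t₀) := hS.rate_cont.add hS'.rate_cont
  have hcpos : ∀ s, t₀ ≤ s → 0 < c s := fun s hs => add_pos (hS.rate_pos hs) (hS'.rate_pos hs)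
  have hmono : ∀ p r s q, t₀ ≤ p → p ≤ r → r ≤ s → s ≤ q →
      ∫ u in r..s, c u ≤ ∫ u in p..q, c u := by
    intro p r s q hp hpr hrs hsq
    refine intervalIntegral.integral_mono_interval hpr hrs hsq ?_
      (hc.intervalIntegrable_of_Ici hp (by linarith))
    filter_upwards [MeasureTheory.ae_restrict_mem measurableSet_Ioc] with u hu
    exact (hcpos u (hp.trans hu.1.le)).le
  have hI0 : 0 ≤ ∫ u in t₀..(T + S.τ), c u := by
    simpa using hmono t₀ t₀ t₀ (T + S.τ) le_rfl le_rfl le_rfl (by linarith)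
  -- The integral covers σ ≤ T. For σ ≥ T each rate integrates over [σ, σ+τ] to at most B₁(σ+τ) or
  -- B₂(σ+τ), hence to at most 1: this is the 2.
  refine ⟨(∫ u in t₀..(T + S.τ), c u) + 2, ?_⟩
  intro σ hσ φ ω x y h hφ t ht1 ht2 htω
  rcases le_total t σ with htσ | htσ
  · refine (hφ.max_abs_le t ⟨ht1, htσ⟩).trans ?_
    exact le_mul_of_one_le_right (norm_nonneg φ) (Real.one_le_exp (by linarith))
  · refine (h.max_abs_le_exp hS hS' hσ (norm_nonneg φ) hφ.max_abs_le htσ htω).trans ?_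
    gcongr
    change ∫ u in σ..t, c u ≤ _
    rcases le_total σ T with hσT | hσT
    · rw [max_eq_right hσT] at ht2
      linarith [hmono t₀ σ t (T + S.τ) le_rfl hσ htσ ht2]
    · rw [max_eq_left hσT] at ht2
      have e1 := hmono σ σ t (σ + S.τ) hσ le_rfl htσ ht2
      have e2 := (hS.integral_rate_le_B₁ (t := σ + S.τ) (by linarith)).trans
        (hB₁ _ (by linarith))
      have e3 : ∫ s in (σ + S.τ - S.τ)..(σ + S.τ), S.swap.rate H s ≤ 1 :=
        (hS'.integral_rate_le_B₁ (t := σ + S.τ) (by linarith)).trans (hB₂ _ (by linarith))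
      rw [add_sub_cancel_right] at e2 e3
      have e4 : ∫ u in σ..(σ + S.τ), c u = (∫ u in σ..(σ + S.τ), S.rate G u)
          + ∫ u in σ..(σ + S.τ), S.swap.rate H u :=
        intervalIntegral.integral_add (hS.rate_cont.intervalIntegrable_of_Ici hσ (by linarith))
          (hS'.rate_cont.intervalIntegrable_of_Ici hσ (by linarith))
      linarith

/-- Decay at rate `α`, uniformly in the initial time, as soon as `α` is dominated by the
coefficients; `α = 0` gives uniform stability. -/
theorem exists_uniform_decay (hS : S.FirstBounds t₀ G) (hS' : S.swap.FirstBounds t₀ H)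
    {T α β : ℝ} (hT : t₀ ≤ T) (hα : 0 ≤ α) (hβ : β ≤ 1) (hB₁ : ∀ t, T ≤ t → S.B₁ G t ≤ β)
    (hB₂ : ∀ t, T ≤ t → S.B₂ H t ≤ β)
    (haα : ∀ t, T ≤ t → α < S.a t * (1 - β * Real.exp (α * (2 * S.τ))))
    (hbα : ∀ t, T ≤ t → α < S.b t * (1 - β * Real.exp (α * (2 * S.τ)))) :
    ∃ K : ℝ, 0 < K ∧ ∀ σ, t₀ ≤ σ → ∀ (φ : S.Phase) (ω : EReal) (x y : ℝ → ℝ),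
      S.IsSolution σ ω x y → S.HasInitialCondition σ φ x y →
      ∀ t, σ ≤ t → (t : EReal) < ω →
        max |x t| |y t| ≤ K * Real.exp (-α * (t - σ)) * ‖φ‖ := by
  have hτ := hS.τ_pos
  obtain ⟨C, hC⟩ := exists_uniform_bound hS hS' hT (fun t ht => (hB₁ t ht).trans hβ)
    (fun t ht => (hB₂ t ht).trans hβ)
  refine ⟨Real.exp C * Real.exp (α * (T - t₀ + S.τ)), by positivity, ?_⟩
  intro σ hσ φ ω x y h hφ t ht htω
  set p := max σ T + S.τ
  have hσp : σ + S.τ ≤ p := by simp [p]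
  have hTp : T + S.τ ≤ p := by simp [p]
  have hpσ : p - σ ≤ T - t₀ + S.τ := by
    have : max σ T ≤ σ + (T - t₀) := max_le (by linarith) (by linarith)
    simp only [p]; linarith
  have hfin : ∀ r, r ≤ α * (p - t) → max |x t| |y t| ≤ ‖φ‖ * Real.exp C * Real.exp r →
      max |x t| |y t|
        ≤ Real.exp C * Real.exp (α * (T - t₀ + S.τ)) * Real.exp (-α * (t - σ)) * ‖φ‖ := by
    intro r hr hle
    refine hle.trans ?_
    have e1 : r ≤ α * (T - t₀ + S.τ) + -α * (t - σ) := by nlinarith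
    calc ‖φ‖ * Real.exp C * Real.exp r
        ≤ ‖φ‖ * Real.exp C * Real.exp (α * (T - t₀ + S.τ) + -α * (t - σ)) := by gcongr
      _ = _ := by rw [Real.exp_add]; ring
  rcases le_total t p with htp | htp
  · refine hfin 0 (mul_nonneg hα (by linarith)) ?_
    rw [Real.exp_zero, mul_one]
    exact hC σ hσ φ ω x y h hφ t (by linarith) htp htω
  · refine hfin (-α * (t - p)) (by linarith) ?_
    have hT' : ∀ s, p ≤ s → T ≤ s := fun s hs => by linarith
    refine h.max_abs_le_exp_neg hS hS' hσ (by positivity) hα hσp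
      (fun s hs => hB₁ s (hT' s hs)) (fun s hs => hB₂ s (hT' s hs))
      (fun s hs => haα s (hT' s hs)) (fun s hs => hbα s (hT' s hs)) (fun s hs => ?_) htp htω
    exact hC σ hσ φ ω x y h hφ s (by linarith [hs.1]) hs.2
      ((EReal.coe_le_coe_iff.2 (hs.2.trans htp)).trans_lt htω)

theorem exists_uniform_stability (hS : S.FirstBounds t₀ G) (hS' : S.swap.FirstBounds t₀ H)
    {T β : ℝ} (hT : t₀ ≤ T) (hβ : β < 1) (hB₁ : ∀ t, T ≤ t → S.B₁ G t ≤ β)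
    (hB₂ : ∀ t, T ≤ t → S.B₂ H t ≤ β) :
    ∃ K : ℝ, 0 < K ∧ ∀ σ, t₀ ≤ σ → ∀ (φ : S.Phase) (ω : EReal) (x y : ℝ → ℝ),
      S.IsSolution σ ω x y → S.HasInitialCondition σ φ x y →
      ∀ t, σ ≤ t → (t : EReal) < ω → max |x t| |y t| ≤ K * ‖φ‖ := by
  obtain ⟨K, hK, hbound⟩ := exists_uniform_decay hS hS' hT le_rfl hβ.le hB₁ hB₂
    (fun t ht => by simpa using mul_pos (hS.a_pos t (hT.trans ht)) (sub_pos.2 hβ))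
    (fun t ht => by
      simpa using mul_pos (show 0 < S.b t from hS'.a_pos t (hT.trans ht)) (sub_pos.2 hβ))
  exact ⟨K, hK, by simpa using hbound⟩

/-! ### Contraction of eventual bounds and attractivity -/

theorem IsSolution.eventually_max_abs_le (h : S.IsSolution σ ⊤ x y) (hS : S.FirstBounds t₀ G)
    (hS' : S.swap.FirstBounds t₀ H) (hσ : t₀ ≤ σ)
    (hdiva : Tendsto (fun T => ∫ t in t₀..T, S.a t) atTop atTop)
    (hdivb : Tendsto (fun T => ∫ t in t₀..T, S.b t) atTop atTop) {β β' m : ℝ} (hm : 0 < m)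
    (hβ : β < β') (hB₁ : ∀ᶠ t in atTop, S.B₁ G t ≤ β) (hB₂ : ∀ᶠ t in atTop, S.B₂ H t ≤ β)
    (hxy : ∀ᶠ t in atTop, max |x t| |y t| ≤ m) :
    ∀ᶠ t in atTop, max |x t| |y t| ≤ β' * m := by
  have h2 := hS'.eventually_abs_le h.swap hσ hdivb hm hβ hB₂
    (hxy.mono fun t ht => by rwa [max_comm])
  filter_upwards [hS.eventually_abs_le h hσ hdiva hm hβ hB₁ hxy, h2] with t h1 h2
  exact max_le h1 h2

theorem IsSolution.tendsto_zero (h : S.IsSolution σ ⊤ x y) (hS : S.FirstBounds t₀ G)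
    (hS' : S.swap.FirstBounds t₀ H) (hσ : t₀ ≤ σ)
    (hdiva : Tendsto (fun T => ∫ t in t₀..T, S.a t) atTop atTop)
    (hdivb : Tendsto (fun T => ∫ t in t₀..T, S.b t) atTop atTop) {β m : ℝ} (hβ0 : 0 ≤ β)
    (hβ : β < 1) (hB₁ : ∀ᶠ t in atTop, S.B₁ G t ≤ β) (hB₂ : ∀ᶠ t in atTop, S.B₂ H t ≤ β)
    (hxy : ∀ᶠ t in atTop, max |x t| |y t| ≤ m) :
    Tendsto x atTop (𝓝 0) ∧ Tendsto y atTop (𝓝 0) := by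
  obtain ⟨β', hββ', hβ'⟩ := exists_between hβ
  have hβ'0 : 0 < β' := hβ0.trans_lt hββ'
  -- The contraction step needs a positive bound.
  set m' := max m 1
  have hm' : 0 < m' := lt_max_of_lt_right one_pos
  have hn : ∀ n : ℕ, ∀ᶠ t in atTop, max |x t| |y t| ≤ β' ^ n * m' := by
    intro n
    induction n with
    | zero =>
      rw [pow_zero, one_mul]
      exact hxy.mono fun t ht => ht.trans (le_max_left m 1)
    | succ n ih =>
      have := h.eventually_max_abs_le hS hS' hσ hdiva hdivb (by positivity) hββ' hB₁ hB₂ ih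
      filter_upwards [this] with t ht
      rwa [pow_succ', mul_assoc]
  have hlim : Tendsto (fun n : ℕ => β' ^ n * m') atTop (𝓝 0) := by
    simpa using (tendsto_pow_atTop_nhds_zero_of_lt_one hβ'0.le hβ').mul_const m'
  have hz : Tendsto (fun t => max |x t| |y t|) atTop (𝓝 0) := by
    refine tendsto_order.2 ⟨fun e he => Eventually.of_forall fun t =>
      he.trans_le ((abs_nonneg _).trans (le_max_left _ _)), fun e he => ?_⟩
    obtain ⟨n, hne⟩ := (hlim.eventually (gt_mem_nhds he)).exists
    exact (hn n).mono fun t ht => ht.trans_lt hne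
  exact ⟨squeeze_zero_norm (fun t => le_max_left _ _) hz,
    squeeze_zero_norm (fun t => le_max_right _ _) hz⟩

end RichardsonSystem

/-! ### Constants from the limit hypotheses, and conclusion -/

theorem exists_lt_one_eventually_le_of_limsup_lt_one {f : ℝ → ℝ}
    (h : limsup (fun t => ((f t : ℝ) : EReal)) atTop < 1) :
    ∃ β : ℝ, β < 1 ∧ ∀ᶠ t in atTop, f t ≤ β := by
  obtain ⟨β, h1, h2⟩ := EReal.lt_iff_exists_real_btwn.1 h
  refine ⟨β, by exact_mod_cast h2, (eventually_lt_of_limsup_lt h1).mono fun t ht => ?_⟩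
  exact (EReal.coe_lt_coe_iff.1 ht).le

theorem exists_pos_eventually_le_of_pos_liminf {f : ℝ → ℝ}
    (h : 0 < liminf (fun t => ((f t : ℝ) : EReal)) atTop) :
    ∃ r : ℝ, 0 < r ∧ ∀ᶠ t in atTop, r ≤ f t := by
  obtain ⟨r, h1, h2⟩ := EReal.lt_iff_exists_real_btwn.1 h
  refine ⟨r, by exact_mod_cast h1, (eventually_lt_of_lt_liminf h2).mono fun t ht => ?_⟩
  exact (EReal.coe_lt_coe_iff.1 ht).le

/-- At α = 0 the second inequality reads 0 < r (1 - β); by continuity it persists for small α > 0.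
-/
theorem exists_decay_rate {r β : ℝ} (c : ℝ) (hr : 0 < r) (hβ : β < 1) :
    ∃ α : ℝ, 0 < α ∧ α < r * (1 - β * Real.exp (α * c)) := by
  have hc : Continuous fun α : ℝ => r * (1 - β * Real.exp (α * c)) - α := by fun_prop
  have h0 : (0 : ℝ) < r * (1 - β * Real.exp (0 * c)) - 0 := by
    simpa using mul_pos hr (sub_pos.2 hβ)
  have h1 : ∀ᶠ α in 𝓝[>] (0 : ℝ), 0 < r * (1 - β * Real.exp (α * c)) - α :=
    (hc.continuousAt.eventually (lt_mem_nhds h0)).filter_mono nhdsWithin_le_nhds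
  obtain ⟨α, h2, h3⟩ := (h1.and self_mem_nhdsWithin).exists
  exact ⟨α, h3, by linarith⟩

theorem theorem3p2 (S : RichardsonSystem) (t₀ : ℝ) (G H : ℝ → ℝ)
    -- the system: positive delay, continuous coefficients and hostility terms
    (hτ : 0 < S.τ)
    (ha : ContinuousOn S.a (Set.Ici t₀)) (hb : ContinuousOn S.b (Set.Ici t₀))
    (hk : ContinuousOn S.k (Set.Ici t₀)) (hl : ContinuousOn S.l (Set.Ici t₀))
    (ha_pos : ∀ t, t₀ ≤ t → 0 < S.a t) (hb_pos : ∀ t, t₀ ≤ t → 0 < S.b t)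
    (hk_nonneg : ∀ t, t₀ ≤ t → 0 ≤ S.k t) (hl_nonneg : ∀ t, t₀ ≤ t → 0 ≤ S.l t)
    (hg : ContinuousOn (fun p : ℝ × ℝ × ℝ × ℝ × ℝ => S.g p.1 p.2.1 p.2.2.1 p.2.2.2.1 p.2.2.2.2)
      (Set.Ici t₀ ×ˢ Set.univ))
    (hh : ContinuousOn (fun p : ℝ × ℝ × ℝ × ℝ × ℝ => S.h p.1 p.2.1 p.2.2.1 p.2.2.2.1 p.2.2.2.2)
      (Set.Ici t₀ ×ˢ Set.univ))
    -- (ii)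
    (hG : ContinuousOn G (Set.Ici t₀)) (hH : ContinuousOn H (Set.Ici t₀))
    (hG_nonneg : ∀ t, t₀ ≤ t → 0 ≤ G t) (hH_nonneg : ∀ t, t₀ ≤ t → 0 ≤ H t)
    (hgG : ∀ t, t₀ ≤ t → ∀ x y u v : ℝ,
      |S.g t x y u v| ≤ G t * max (max |x| |y|) (max |u| |v|))
    (hhH : ∀ t, t₀ ≤ t → ∀ x y u v : ℝ,
      |S.h t x y u v| ≤ H t * max (max |x| |y|) (max |u| |v|))
    -- (iii), with the upper limits taken in the extended reals
    (hB₁ : Filter.limsup (fun t : ℝ => ((S.B₁ G t : ℝ) : EReal)) Filter.atTop < 1)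
    (hB₂ : Filter.limsup (fun t : ℝ => ((S.B₂ H t : ℝ) : EReal)) Filter.atTop < 1) :
    -- under (i): stability and global attractivity
    ((Filter.Tendsto (fun T : ℝ => ∫ t in t₀..T, S.a t) Filter.atTop Filter.atTop ∧
      Filter.Tendsto (fun T : ℝ => ∫ t in t₀..T, S.b t) Filter.atTop Filter.atTop) →
        S.ZeroStable t₀ ∧ S.ZeroGloballyAttractive t₀) ∧
    -- under (i'): global exponential stability
    ((0 < Filter.liminf (fun t : ℝ => ((S.a t : ℝ) : EReal)) Filter.atTop ∧
      0 < Filter.liminf (fun t : ℝ => ((S.b t : ℝ) : EReal)) Filter.atTop) →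
        S.ZeroGloballyExponentiallyStable t₀) := by
  have hS : S.FirstBounds t₀ G := ⟨hτ, ha, hk, hG, ha_pos, hk_nonneg, hG_nonneg, hgG⟩
  have hS' : S.swap.FirstBounds t₀ H := ⟨hτ, hb, hl, hH, hb_pos, hl_nonneg, hH_nonneg, hhH⟩
  obtain ⟨β₁, hβ₁, hev₁⟩ := exists_lt_one_eventually_le_of_limsup_lt_one hB₁
  obtain ⟨β₂, hβ₂, hev₂⟩ := exists_lt_one_eventually_le_of_limsup_lt_one hB₂
  -- Nonnegativity of β keeps the contraction factor β' > β positive.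
  obtain ⟨β, hβ0, hβ, hβ₁', hβ₂'⟩ : ∃ β : ℝ, 0 ≤ β ∧ β < 1 ∧ β₁ ≤ β ∧ β₂ ≤ β :=
    ⟨max 0 (max β₁ β₂), le_max_left _ _, max_lt one_pos (max_lt hβ₁ hβ₂),
      (le_max_left _ _).trans (le_max_right _ _), (le_max_right _ _).trans (le_max_right _ _)⟩
  replace hev₁ : ∀ᶠ t in atTop, S.B₁ G t ≤ β := hev₁.mono fun t ht => ht.trans hβ₁'
  replace hev₂ : ∀ᶠ t in atTop, S.B₂ H t ≤ β := hev₂.mono fun t ht => ht.trans hβ₂'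
  constructor
  · rintro ⟨hdiva, hdivb⟩
    obtain ⟨T, hT⟩ := eventually_atTop.1 ((hev₁.and hev₂).and (eventually_ge_atTop t₀))
    obtain ⟨K, hK, hbound⟩ := RichardsonSystem.exists_uniform_stability hS hS' (hT T le_rfl).2 hβ
      (fun t ht => (hT t ht).1.1) (fun t ht => (hT t ht).1.2)
    constructor
    · intro σ hσ ε hε
      refine ⟨ε / K, div_pos hε hK, fun φ hφ ω x y h hic t ht htω => ?_⟩
      refine (hbound σ hσ φ ω x y h hic t ht htω).trans_lt ?_
      rw [mul_comm]
      exact (lt_div_iff₀ hK).1 hφ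
    · intro σ hσ φ x y h hic
      refine h.tendsto_zero hS hS' hσ hdiva hdivb hβ0 hβ hev₁ hev₂ (m := K * ‖φ‖) ?_
      filter_upwards [eventually_ge_atTop σ] with t ht
      exact hbound σ hσ φ ⊤ x y h hic t ht (EReal.coe_lt_top t)
  · rintro ⟨hla, hlb⟩
    obtain ⟨r₁, hr₁, hra⟩ := exists_pos_eventually_le_of_pos_liminf hla
    obtain ⟨r₂, hr₂, hrb⟩ := exists_pos_eventually_le_of_pos_liminf hlb
    obtain ⟨α, hα, hlt⟩ := exists_decay_rate (2 * S.τ) (lt_min hr₁ hr₂) hβ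
    obtain ⟨T, hT⟩ := eventually_atTop.1
      (((hev₁.and hev₂).and (hra.and hrb)).and (eventually_ge_atTop t₀))
    -- The sign is needed to replace min r₁ r₂ by the larger a(t) or b(t) in the rate condition.
    have hfac : 0 < 1 - β * Real.exp (α * (2 * S.τ)) :=
      pos_of_mul_pos_right (hα.trans hlt) (lt_min hr₁ hr₂).le
    obtain ⟨K, hK, hbound⟩ := RichardsonSystem.exists_uniform_decay hS hS' (hT T le_rfl).2 hα.le
      hβ.le (fun t ht => (hT t ht).1.1.1) (fun t ht => (hT t ht).1.1.2)
      (fun t ht => hlt.trans_le (mul_le_mul_of_nonneg_right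
        ((min_le_left _ _).trans (hT t ht).1.2.1) hfac.le))
      (fun t ht => hlt.trans_le (mul_le_mul_of_nonneg_right
        ((min_le_right _ _).trans (hT t ht).1.2.2) hfac.le))
    exact ⟨K, α, hK, hα, hbound⟩
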